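/- All Lie algebras are real. A Kähler structure on a finite-dimensional Lie algebra $\mathfrak g$ is a pair $(J,\omega)$, where $J$ is an endomorphism of $\mathfrak g$ with $J^2=-1$ and $[Jx,Jy]-[x,y]-J[Jx,y]-J[x,Jy]=0$ for all $x,y$, and $\omega$ is a nondegenerate alternating bilinear form with $\omega([x,y],z)+\omega([y,z],x)+\omega([z,x],y)=0$ and $\omega(Jx,Jy)=\omega(x,y)$ for all $x,y,z$. The associated symmetric nondegenerate form $g(x,y)=\omega(Jx,y)$, not necessarily definite, is called a pseudo-Kähler metric, and $\mathfrak g$ is called a Kähler Lie algebra if it admits a Kähler structure. The Levi-Civita connection $\nabla$ of $g$ is given by $2g(\nabla_xy,z)=g([x,y],z)-g([y,z],x)+g([z,x],y)$. Its curvature is $R(x,y)=[\nabla_x,\nabla_y]-\nabla_{[x,y]}$ and its Ricci tensor is $ric(x,y)=-\mathrm{tr}(v\mapsto R(x,v)y)$. The metric $g$ is flat if $R=0$ and Ricci flat if $ric=0$. The connection is complete if for every initial value the geodesic equation $\dot x(t)=-\nabla_{x(t)}x(t)$ in $\mathfrak g$ has a solution defined for all $t\in\mathbb R$. $\mathfrak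 g$ is unimodular if $\mathrm{tr}(\mathrm{ad}_x)=0$ for all $x\in\mathfrak g$. **Theorem.** Let $\mathfrak g$ be a four-dimensional real Lie algebra. 1. If $\mathfrak g$ is unimodular, then every pseudo-Kähler metric $g$ on $\mathfrak g$ is flat and its Levi-Civita connection is complete. In particular, if such a $g$ is Ricci flat, then it is flat. 2. $\mathfrak g$ is a unimodular Kähler Lie algebra if and only if it is abelian, or isomorphic to $\mathbb R\times\mathfrak h_3$, or isomorphic to $\mathbb R\times\mathfrak e(2)$. Here $\mathfrak h_3$ is the three-dimensional Heisenberg Lie algebra and $\mathfrak e(2)$ is the Lie algebra of the group of rigid motions of $\mathbb R^2$. -/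

import Mathlib

-- `ℝ` and matrix algebras carry the commutator bracket.
attribute [local instance 100] LieRing.ofAssociativeRing

noncomputable section

namespace PseudoKahler

/-! ### Kähler structures on a real Lie algebra -/

section Structures

variable {𝔤 : Type*} [LieRing 𝔤] [LieAlgebra ℝ 𝔤]

/-- A complex structure on `𝔤`: an endomorphism `J` with `J² = -1` and vanishing Nijenhuis
tensor. -/
structure IsComplexStructure (J : 𝔤 →ₗ[ℝ] 𝔤) : Prop where
  sq : ∀ x, J (J x) = -x
  integrable : ∀ x y, ⁅J x, J y⁆ - ⁅x, y⁆ - J ⁅J x, y⁆ - J ⁅x, J y⁆ = 0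

/-- A symplectic structure on `𝔤`: a closed 2-form of maximal rank. -/
structure IsSymplecticStructure (ω : LinearMap.BilinForm ℝ 𝔤) : Prop where
  alt : ∀ x, ω x x = 0
  closed : ∀ x y z, ω ⁅x, y⁆ z + ω ⁅y, z⁆ x + ω ⁅z, x⁆ y = 0
  nondegenerate : ω.Nondegenerate

/-- A Kähler structure on `𝔤`: a complex structure together with a compatible symplectic
structure. No definiteness is required. -/
structure IsKahlerStructure (J : 𝔤 →ₗ[ℝ] 𝔤) (ω : LinearMap.BilinForm ℝ 𝔤) : Prop where
  complex : IsComplexStructure J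
  symplectic : IsSymplecticStructure ω
  compatible : ∀ x y, ω (J x) (J y) = ω x y

/-- `g` is a pseudo-Kähler metric on `𝔤`: `g(x, y) = ω(Jx, y)` for some Kähler structure
`(J, ω)`. -/
def IsPseudoKahlerMetric (g : LinearMap.BilinForm ℝ 𝔤) : Prop :=
  ∃ (J : 𝔤 →ₗ[ℝ] 𝔤) (ω : LinearMap.BilinForm ℝ 𝔤),
    IsKahlerStructure J ω ∧ ∀ x y, g x y = ω (J x) y

variable (𝔤) in
/-- A Kähler Lie algebra is a Lie algebra that carries a Kähler structure. -/
def IsKahlerLieAlgebra : Prop :=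
  ∃ (J : 𝔤 →ₗ[ℝ] 𝔤) (ω : LinearMap.BilinForm ℝ 𝔤), IsKahlerStructure J ω

variable (𝔤) in
/-- `𝔤` is unimodular if `tr (ad x) = 0` for every `x`. -/
def IsUnimodular : Prop :=
  ∀ x : 𝔤, LinearMap.trace ℝ 𝔤 (LieAlgebra.ad ℝ 𝔤 x) = 0

/-- A pseudo-Kähler metric is symmetric. -/
theorem IsPseudoKahlerMetric.symm {g : LinearMap.BilinForm ℝ 𝔤} (hg : IsPseudoKahlerMetric g)
    (x y : 𝔤) : g x y = g y x := by
  obtain ⟨J, ω, h, hgω⟩ := hg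
  have hneg : ∀ u v, ω u v = -ω v u := fun u v => by
    have := h.symplectic.alt (u + v)
    simp only [map_add, LinearMap.add_apply, h.symplectic.alt] at this
    linarith
  rw [hgω, hgω, ← h.compatible, h.complex.sq, hneg]
  simp

/-- A pseudo-Kähler metric is nondegenerate. -/
theorem IsPseudoKahlerMetric.nondegenerate {g : LinearMap.BilinForm ℝ 𝔤}
    (hg : IsPseudoKahlerMetric g) : g.Nondegenerate := by
  have hs := hg.symm
  have hl : ∀ x, (∀ y, g x y = 0) → x = 0 := by
    obtain ⟨J, ω, h, hgω⟩ := hg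
    intro x hx
    have h0 : J x = 0 := h.symplectic.nondegenerate.1 _ fun y => by rw [← hgω]; exact hx y
    have := h.complex.sq x
    rw [h0, map_zero] at this
    simpa using this.symm
  exact ⟨hl, fun y hy => hl y fun x => by rw [hs]; exact hy x⟩

end Structures

/-! ### Left-invariant pseudo-Riemannian geometry at the level of the Lie algebra -/

section Geometry

variable {𝔤 : Type*} [LieRing 𝔤] [LieAlgebra ℝ 𝔤] [FiniteDimensional ℝ 𝔤]

/-- The linear form `z ↦ ½ (g([x,y],z) - g([y,z],x) + g([z,x],y))`. -/
def koszulForm (g : LinearMap.BilinForm ℝ 𝔤) (x y : 𝔤) : Module.Dual ℝ 𝔤 where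
  toFun z := (1 / 2 : ℝ) * (g ⁅x, y⁆ z - g ⁅y, z⁆ x + g ⁅z, x⁆ y)
  map_add' a b := by
    simp only [lie_add, add_lie, map_add, LinearMap.add_apply]; ring
  map_smul' c a := by
    simp only [lie_smul, smul_lie, map_smul, LinearMap.smul_apply, smul_eq_mul,
      RingHom.id_apply]; ring

/-- The Levi-Civita connection of the nondegenerate form `g`: `∇_x y` is the vector that
represents `koszulForm g x y` with respect to `g`. -/
def leviCivita (g : LinearMap.BilinForm ℝ 𝔤) (hg : g.Nondegenerate) : 𝔤 →ₗ[ℝ] 𝔤 →ₗ[ℝ] 𝔤 :=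
  LinearMap.mk₂ ℝ (fun x y => (LinearMap.BilinForm.toDual g hg).symm (koszulForm g x y))
    (fun a b y => by
      rw [← map_add]; congr 1; ext z
      simp only [koszulForm, LinearMap.coe_mk, AddHom.coe_mk, LinearMap.add_apply, lie_add,
        add_lie, map_add]; ring)
    (fun c a y => by
      rw [← map_smul]; congr 1; ext z
      simp only [koszulForm, LinearMap.coe_mk, AddHom.coe_mk, LinearMap.smul_apply, lie_smul,
        smul_lie, map_smul, smul_eq_mul]; ring)
    (fun x a b => by
      rw [← map_add]; congr 1; ext z
      simp only [koszulForm, LinearMap.coe_mk, AddHom.coe_mk, LinearMap.add_apply, lie_add,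
        add_lie, map_add]; ring)
    (fun c x a => by
      rw [← map_smul]; congr 1; ext z
      simp only [koszulForm, LinearMap.coe_mk, AddHom.coe_mk, LinearMap.smul_apply, lie_smul,
        smul_lie, map_smul, smul_eq_mul]; ring)

/-- The Koszul formula. -/
theorem leviCivita_koszul (g : LinearMap.BilinForm ℝ 𝔤) (hg : g.Nondegenerate) (x y z : 𝔤) :
    2 * g (leviCivita g hg x y) z = g ⁅x, y⁆ z - g ⁅y, z⁆ x + g ⁅z, x⁆ y := by
  have h : g (leviCivita g hg x y) z = koszulForm g x y z :=
    LinearMap.BilinForm.apply_toDual_symm_apply (hB := hg) _ _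
  rw [h]
  simp only [koszulForm, LinearMap.coe_mk, AddHom.coe_mk]
  ring

/-- The curvature tensor `(x, y) ↦ R(x, y) = [∇_x, ∇_y] - ∇_{[x, y]}`. -/
def curvature (g : LinearMap.BilinForm ℝ 𝔤) (hg : g.Nondegenerate) (x y : 𝔤) :
    Module.End ℝ 𝔤 :=
  ⁅leviCivita g hg x, leviCivita g hg y⁆ - leviCivita g hg ⁅x, y⁆

/-- The linear map `v ↦ R(x, v) y`. -/
def curvatureMap (g : LinearMap.BilinForm ℝ 𝔤) (hg : g.Nondegenerate) (x y : 𝔤) :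
    𝔤 →ₗ[ℝ] 𝔤 where
  toFun v := curvature g hg x v y
  map_add' a b := by
    simp only [curvature, LinearMap.sub_apply, Ring.lie_def, Module.End.mul_apply, map_add,
      lie_add, LinearMap.add_apply]; abel
  map_smul' c a := by
    simp only [curvature, LinearMap.sub_apply, Ring.lie_def, Module.End.mul_apply, map_smul,
      lie_smul, LinearMap.smul_apply, RingHom.id_apply, smul_sub]

/-- The Ricci tensor `ric(x, y) = -tr (v ↦ R(x, v) y)`. -/
def ricci (g : LinearMap.BilinForm ℝ 𝔤) (hg : g.Nondegenerate) (x y : 𝔤) : ℝ :=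
  -LinearMap.trace ℝ 𝔤 (curvatureMap g hg x y)

/-- In an orthonormal frame, `ric(x, y) = -∑ᵢ εᵢ g(R(x, vᵢ) y, vᵢ)` with `εᵢ = g(vᵢ, vᵢ)`. -/
theorem ricci_eq_sum (g : LinearMap.BilinForm ℝ 𝔤) (hg : g.Nondegenerate)
    {ι : Type*} [Fintype ι] [DecidableEq ι] (v : Module.Basis ι ℝ 𝔤)
    (hv : ∀ i j, i ≠ j → g (v i) (v j) = 0) (hε : ∀ i, g (v i) (v i) = 1 ∨ g (v i) (v i) = -1)
    (x y : 𝔤) :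
    ricci g hg x y = -∑ i, g (v i) (v i) * g (curvature g hg x (v i) y) (v i) := by
  have key : ∀ w i, v.repr w i = g (v i) (v i) * g w (v i) := by
    intro w i
    have h1 : g w (v i) = v.repr w i * g (v i) (v i) := by
      conv_lhs => rw [← v.sum_repr w]
      simp only [map_sum, map_smul, LinearMap.sum_apply, LinearMap.smul_apply, smul_eq_mul]
      rw [Finset.sum_eq_single i]
      · intro j _ hj
        rw [hv j i hj, mul_zero]
      · simp
    rw [h1]
    rcases hε i with h | h <;> rw [h] <;> ring
  rw [ricci, LinearMap.trace_eq_matrix_trace ℝ v, Matrix.trace]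
  simp only [Matrix.diag_apply, LinearMap.toMatrix_apply, key]
  rfl

/-- The metric is flat: its curvature tensor vanishes. -/
def IsFlat (g : LinearMap.BilinForm ℝ 𝔤) (hg : g.Nondegenerate) : Prop :=
  ∀ x y, curvature g hg x y = 0

/-- The metric is Ricci flat: its Ricci tensor vanishes. -/
def IsRicciFlat (g : LinearMap.BilinForm ℝ 𝔤) (hg : g.Nondegenerate) : Prop :=
  ∀ x y, ricci g hg x y = 0

/-- The Levi-Civita connection is complete: for every initial value, the geodesic equation
`x'(t) = -∇_{x(t)} x(t)` in `𝔤` has a solution defined for all `t ∈ ℝ`. The derivative of the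
curve in the finite-dimensional space `𝔤` is taken componentwise, i.e. after applying an arbitrary
linear form. -/
def IsGeodesicallyComplete (g : LinearMap.BilinForm ℝ 𝔤) (hg : g.Nondegenerate) : Prop :=
  ∀ x₀ : 𝔤, ∃ x : ℝ → 𝔤, x 0 = x₀ ∧
    ∀ (φ : Module.Dual ℝ 𝔤) (t : ℝ),
      HasDerivAt (fun s => φ (x s)) (φ (-leviCivita g hg (x t) (x t))) t

end Geometry

/-! ### The two model algebras -/

/-- The Heisenberg Lie algebra `𝔥₃`: strictly upper triangular real `3 × 3` matrices. -/
def heisenberg3 : LieSubalgebra ℝ (Matrix (Fin 3) (Fin 3) ℝ) where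
  carrier := {A | ∀ i j, j ≤ i → A i j = 0}
  zero_mem' := fun _ _ _ => rfl
  add_mem' := fun {A B} hA hB i j h => by simp [hA i j h, hB i j h]
  smul_mem' := fun c A hA i j h => by simp [hA i j h]
  lie_mem' := fun {A B} hA hB i j h => by
    rw [Ring.lie_def, Matrix.sub_apply, Matrix.mul_apply, Matrix.mul_apply,
      Finset.sum_eq_zero, Finset.sum_eq_zero, sub_zero]
    all_goals
      intro k _
      rcases le_total k i with hk | hk
      · simp [hA i k hk, hB i k hk]
      · simp [hA k j (h.trans hk), hB k j (h.trans hk)]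

/-- The Lie algebra `𝔢(2)` of the group of rigid motions of `ℝ²`: real `3 × 3` matrices
`[[0, -θ, a], [θ, 0, b], [0, 0, 0]]`. -/
def euclidean2 : LieSubalgebra ℝ (Matrix (Fin 3) (Fin 3) ℝ) where
  carrier := {A | A 0 0 = 0 ∧ A 1 1 = 0 ∧ A 0 1 = -A 1 0 ∧ ∀ j, A 2 j = 0}
  zero_mem' := by simp
  add_mem' := by
    rintro A B ⟨h1, h2, h3, h4⟩ ⟨k1, k2, k3, k4⟩
    refine ⟨by simp [h1, k1], by simp [h2, k2], by simp [h3, k3]; ring, fun j => by simp [h4, k4]⟩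
  smul_mem' := by
    rintro c A ⟨h1, h2, h3, h4⟩
    refine ⟨by simp [h1], by simp [h2], by simp [h3], fun j => by simp [h4]⟩
  lie_mem' := by
    rintro A B ⟨h1, h2, h3, h4⟩ ⟨k1, k2, k3, k4⟩
    refine ⟨?_, ?_, ?_, fun j => ?_⟩ <;>
      simp [Ring.lie_def, Matrix.mul_apply, Fin.sum_univ_three, h1, h2, h3, h4, k1, k2, k3, k4] <;>
      ring

end PseudoKahler

end

/-! For a Kähler structure ∇ commutes with J, so ∇ = A - A' with A complex bilinear and A' its
adjoint for the Hermitian form h = g - i g(J·,·) on the complex plane 𝔤. The curvature has type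
(1,1): the vanishing of its (2,0) part makes A a left-symmetric product, and the Bianchi identity
makes its mixed part symmetric in two arguments. Since ∇_x is skew, unimodularity says exactly that
the right multiplications of A are traceless.

Left symmetry then makes all products of two right multiplications traceless. They span a totally
isotropic subspace of sl₂(ℂ), hence at most a line, generated by a nilpotent map: A x y = ν(x) φ(y)
e with ν(e) = 0 (`exists_rank_one_of_leftSymmetric`). The mixed identity forces φ to be proportional
to h(·, e) unless A = 0 (`exists_hermitian_rank_one`). Therefore ∇_x = l(x) M with M = `skewRankTwo`
and l ∘ M = 0 (`IsKahlerStructure.exists_leviCivita_eq`).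

Flatness is then immediate, and l is constant along geodesics, so their equation is linear on each
trajectory. The bracket is l(x) M y - l(y) M x. If it is nonzero, it gives ℝ × 𝔥₃ when e is
isotropic, where M squares to zero, and ℝ × 𝔢(2) otherwise, where M rotates span(e, Je). Explicit
Kähler structures give the converse. -/

noncomputable section

namespace PseudoKahler

/-! ### Left-symmetric products on a plane and Hermitian forms. -/

section ComplexPlane

open ComplexConjugate

/-- A traceless `2 × 2` matrix orthogonal, for the trace form, to a nonzero traceless isotropic
matrix and itself isotropic is a multiple of it. -/
theorem exists_smul_eq_of_isotropic {K : Type*} [Field K] {M N : Matrix (Fin 2) (Fin 2) K}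
    (h2 : (2 : K) ≠ 0) (hN : N.trace = 0) (hM : M.trace = 0) (hNN : (N * N).trace = 0)
    (hNM : (N * M).trace = 0) (hMM : (M * M).trace = 0) (h0 : N ≠ 0) : ∃ c : K, M = c • N := by
  -- The trace form on traceless 2 × 2 matrices is nondegenerate in dimension three, so its
  -- isotropic subspaces are at most lines. The entries below make this explicit.
  simp only [Matrix.trace_fin_two, Matrix.mul_apply, Fin.sum_univ_two] at *
  have eN : N 1 1 = -N 0 0 := by linear_combination hN
  have eM : M 1 1 = -M 0 0 := by linear_combination hM
  rw [eN] at hNN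
  rw [eN, eM] at hNM
  rw [eM] at hMM
  have q1 : N 0 0 * N 0 0 + N 0 1 * N 1 0 = 0 := by
    apply mul_left_cancel₀ h2; linear_combination hNN
  have q2 : M 0 0 * M 0 0 + M 0 1 * M 1 0 = 0 := by
    apply mul_left_cancel₀ h2; linear_combination hMM
  by_cases hb : N 0 1 = 0
  · by_cases hc : N 1 0 = 0
    · exfalso
      apply h0
      have ha : N 0 0 = 0 := by
        rw [hb] at q1; simpa using q1
      ext i j
      fin_cases i <;> fin_cases j <;> simp [ha, hb, hc, eN]
    · have ha : N 0 0 = 0 := by rw [hb] at q1; simpa using q1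
      have hb' : M 0 1 = 0 := by
        rw [hb, ha] at hNM
        have : N 1 0 * M 0 1 = 0 := by linear_combination hNM
        exact (mul_eq_zero.1 this).resolve_left hc
      have ha' : M 0 0 = 0 := by rw [hb'] at q2; simpa using q2
      refine ⟨M 1 0 / N 1 0, ?_⟩
      ext i j
      fin_cases i <;> fin_cases j <;> simp [ha, hb, eN, eM, ha', hb', hc]
  · have e1 : M 0 0 * N 0 1 = M 0 1 * N 0 0 := by
      have : (M 0 0 * N 0 1 - M 0 1 * N 0 0) ^ 2 = 0 := by
        linear_combination N 0 1 ^ 2 * q2 + M 0 1 ^ 2 * q1 - N 0 1 * M 0 1 * hNM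
      exact sub_eq_zero.1 (pow_eq_zero_iff two_ne_zero |>.1 this)
    have e2 : M 1 0 * N 0 1 = M 0 1 * N 1 0 := by
      apply mul_left_cancel₀ hb
      linear_combination N 0 1 * hNM - 2 * N 0 0 * e1 - 2 * M 0 1 * q1
    refine ⟨M 0 1 / N 0 1, ?_⟩
    ext i j
    fin_cases i <;> fin_cases j <;> simp [eN, eM] <;> field_simp
    · exact e1
    · exact e2
    · exact e1

/-- In a plane, two independent vectors span. -/
theorem exists_smul_add_smul_of_finrank_two {K W : Type*} [Field K] [AddCommGroup W] [Module K W]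
    (hd : Module.finrank K W = 2) {v w : W} (h : LinearIndependent K ![v, w]) (x : W) :
    ∃ a b : K, x = a • v + b • w := by
  have : FiniteDimensional K W := Module.finite_of_finrank_eq_succ hd
  have hs := h.span_eq_top_of_card_eq_finrank' (by simp [hd])
  have hx : x ∈ Submodule.span K (Set.range ![v, w]) := hs ▸ Submodule.mem_top
  rw [Matrix.range_cons, Matrix.range_cons, Matrix.range_empty, Set.union_empty,
    Set.singleton_union, Submodule.mem_span_pair] at hx
  obtain ⟨a, b, h⟩ := hx
  exact ⟨a, b, h.symm⟩

/-- A traceless endomorphism of a plane that is isotropic for the trace form and orthogonal to a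
nonzero such endomorphism is a multiple of it. -/
theorem exists_end_smul_eq_of_isotropic {K W : Type*} [Field K] [AddCommGroup W] [Module K W]
    (hd : Module.finrank K W = 2) {M N : Module.End K W}
    (h2 : (2 : K) ≠ 0) (hN : LinearMap.trace K W N = 0) (hM : LinearMap.trace K W M = 0)
    (hNN : LinearMap.trace K W (N * N) = 0)
    (hNM : LinearMap.trace K W (N * M) = 0) (hMM : LinearMap.trace K W (M * M) = 0)
    (h0 : N ≠ 0) : ∃ c : K, M = c • N := by
  have : FiniteDimensional K W := Module.finite_of_finrank_eq_succ hd
  let b := Module.finBasisOfFinrankEq K W hd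
  simp only [LinearMap.trace_eq_matrix_trace K b, LinearMap.toMatrix_mul] at *
  obtain ⟨c, hc⟩ := exists_smul_eq_of_isotropic h2 hN hM hNN hNM hMM
    (by simpa using h0)
  refine ⟨c, (LinearMap.toMatrix b b).injective ?_⟩
  rw [hc, map_smul]

/-- A traceless endomorphism of a plane that is isotropic for the trace form squares to zero. -/
theorem mul_self_eq_zero_of_trace {K W : Type*} [Field K] [AddCommGroup W] [Module K W]
    (hd : Module.finrank K W = 2) {N : Module.End K W}
    (h2 : (2 : K) ≠ 0) (hN : LinearMap.trace K W N = 0)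
    (hNN : LinearMap.trace K W (N * N) = 0) : N * N = 0 := by
  have : FiniteDimensional K W := Module.finite_of_finrank_eq_succ hd
  let b := Module.finBasisOfFinrankEq K W hd
  apply (LinearMap.toMatrix b b).injective
  simp only [LinearMap.trace_eq_matrix_trace K b, LinearMap.toMatrix_mul, map_zero] at *
  generalize LinearMap.toMatrix b b N = P at *
  simp only [Matrix.trace_fin_two, Matrix.mul_apply, Fin.sum_univ_two] at *
  have e : P 1 1 = -P 0 0 := by linear_combination hN
  rw [e] at hNN
  have q : P 0 0 * P 0 0 + P 0 1 * P 1 0 = 0 := by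
    apply mul_left_cancel₀ h2; linear_combination hNN
  ext i j
  fin_cases i <;> fin_cases j <;>
    simp [Matrix.mul_apply, Fin.sum_univ_two, e]
  · exact q
  · ring
  · ring
  · linear_combination q

/-- A left-symmetric product on a plane whose right multiplications are traceless has the form
`x · y = ν(x) φ(y) e` with `ν(e) = 0`. -/
theorem exists_rank_one_of_leftSymmetric {K W : Type*} [Field K] [AddCommGroup W] [Module K W]
    (hd : Module.finrank K W = 2) (h2 : (2 : K) ≠ 0) (A : W →ₗ[K] W →ₗ[K] W)
    (htr : ∀ x, LinearMap.trace K W (A.flip x) = 0)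
    (hls : ∀ x y z, A x (A y z) - A y (A x z) = A (A x y - A y x) z) :
    ∃ (ν φ : Module.Dual K W) (e : W), ν e = 0 ∧ ∀ x y, A x y = (ν x * φ y) • e := by
  have htr2 : ∀ x y, LinearMap.trace K W (A.flip y * A.flip x) = 0 := by
    intro x y
    -- Left symmetry in terms of right and left multiplications: R_y R_x = R_{xy} - [L_x, R_y]. Both
    -- terms on the right are traceless.
    have h : A.flip y * A.flip x = A.flip (A x y) - (A x * A.flip y - A.flip y * A x) := by
      ext z
      have := hls x z y
      simp only [map_sub, LinearMap.sub_apply] at this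
      simp only [Module.End.mul_apply, LinearMap.sub_apply, LinearMap.flip_apply]
      rw [← sub_eq_zero] at this ⊢
      rw [← this]
      abel
    rw [h, map_sub, map_sub, htr, LinearMap.trace_mul_comm K (A x), sub_self, sub_zero]
  by_cases h0 : A.flip = 0
  · refine ⟨0, 0, 0, by simp, fun x y => ?_⟩
    have : A.flip y x = 0 := by rw [h0]; simp
    simpa using this
  obtain ⟨x₀, hx₀⟩ : ∃ x₀, A.flip x₀ ≠ 0 := by
    by_contra! h
    exact h0 (LinearMap.ext h)
  set N := A.flip x₀ with hNdef
  have hmul : ∀ y, ∃ c : K, A.flip y = c • N := fun y =>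
    exists_end_smul_eq_of_isotropic hd h2 (htr x₀) (htr y) (htr2 _ _) (htr2 _ _)
      (htr2 _ _) hx₀
  have hsq := mul_self_eq_zero_of_trace hd h2 (htr x₀) (htr2 _ _)
  obtain ⟨v, hv⟩ : ∃ v, N v ≠ 0 := by
    by_contra! h
    exact hx₀ (LinearMap.ext h)
  have hNe : N (N v) = 0 := by
    have := congrArg (fun T : Module.End K W => T v) hsq
    exact this
  obtain ⟨ψ, hψ⟩ : ∃ ψ : Module.Dual K W, ψ (N v) = 1 := by
    obtain ⟨ψ, hψ⟩ := not_forall.1 ((Module.forall_dual_apply_eq_zero_iff K (N v)).not.2 hv)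
    exact ⟨(ψ (N v))⁻¹ • ψ, by simp [hψ]⟩
  have hli : LinearIndependent K ![v, N v] := by
    rw [LinearIndependent.pair_iff]
    intro s t h
    have h1 := congrArg N h
    simp only [map_add, map_smul, hNe, smul_zero, add_zero, map_zero] at h1
    have hs : s = 0 := (smul_eq_zero.1 h1).resolve_right hv
    subst hs
    simp only [zero_smul, zero_add] at h
    exact ⟨rfl, (smul_eq_zero.1 h).resolve_right hv⟩
  have hNy : ∀ y, N y = ψ (N y) • N v := by
    intro y
    obtain ⟨a, b, rfl⟩ := exists_smul_add_smul_of_finrank_two hd hli y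
    simp [hNe, hψ]
  -- The image of N is the line of N v, on which ψ is the coordinate; ψ (A v y) is the factor c with
  -- `A.flip y = c • N`.
  refine ⟨ψ ∘ₗ N, ψ ∘ₗ A v, N v, by simp [hNe], fun x y => ?_⟩
  obtain ⟨c, hc⟩ := hmul y
  have h1 : ∀ z, A z y = c • N z := fun z => by
    rw [← LinearMap.flip_apply, hc, LinearMap.smul_apply]
  rw [LinearMap.comp_apply, LinearMap.comp_apply, h1 x, h1 v, map_smul, hψ, hNy x]
  simp [hψ, smul_smul, mul_comm]

/-- The algebraic core: a left-symmetric product on a complex plane, with traceless right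
multiplications, that is compatible with a nondegenerate Hermitian form `h` in the sense that
the mixed part of the curvature satisfies the first Bianchi identity, is of the form
`x · y = μ(x) h(y, e) e` with `μ(e) = 0`. -/
theorem exists_hermitian_rank_one {V : Type*} [AddCommGroup V] [Module ℂ V]
    (hd : Module.finrank ℂ V = 2) (h : V → V → ℂ)
    (hadd : ∀ x y z, h (x + y) z = h x z + h y z) (hsmul : ∀ (c : ℂ) x z, h (c • x) z = c * h x z)
    (hconj : ∀ x y, h y x = conj (h x y))
    (hriesz : ∀ φ : Module.Dual ℂ V, ∃ f, ∀ x, φ x = h x f)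
    (A : V →ₗ[ℂ] V →ₗ[ℂ] V) (A' : V → V → V)
    (hA' : ∀ x y z, h (A x y) z = h y (A' x z))
    (htr : ∀ x, LinearMap.trace ℂ V (A.flip x) = 0)
    (hls : ∀ x y z, A x (A y z) - A y (A x z) = A (A x y - A y x) z)
    (hT : ∀ x y z, A x (A' y z) - A' y (A x z) + A (A' y x) z + A' (A' x y) z =
      A z (A' y x) - A' y (A z x) + A (A' y z) x + A' (A' z y) x) :
    ∃ (e : V) (μ : Module.Dual ℂ V), μ e = 0 ∧ (∀ x y, A x y = (μ x * h y e) • e) ∧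
      ∀ x y, A' x y = (conj (μ x) * h y e) • e := by
  have hadd' : ∀ x y z, h x (y + z) = h x y + h x z := fun x y z => by
    rw [hconj, hadd, map_add, ← hconj, ← hconj]
  have hsmul' : ∀ (c : ℂ) x z, h x (c • z) = conj c * h x z := fun c x z => by
    rw [hconj, hsmul, map_mul, ← hconj]
  have hnd : ∀ w, (∀ x, h x w = 0) → w = 0 := by
    intro w hw
    by_contra hne
    have : FiniteDimensional ℂ V := Module.finite_of_finrank_eq_succ hd
    obtain ⟨φ, hφ⟩ := (Module.forall_dual_apply_eq_zero_iff ℂ w).not.2 hne |> not_forall.1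
    obtain ⟨f, hf⟩ := hriesz φ
    apply hφ
    rw [hf, hconj, hw, map_zero]
  have hneg : ∀ x y z, h x (y - z) = h x y - h x z := fun x y z => by
    rw [sub_eq_add_neg, hadd', ← neg_one_smul ℂ z, hsmul']; simp; ring
  have hext : ∀ v w, (∀ x, h x v = h x w) → v = w := fun v w hvw =>
    sub_eq_zero.1 (hnd _ fun x => by rw [hneg, hvw, sub_self])
  -- The formula for A' is the adjoint of the one for A.
  suffices H : ∃ (e : V) (μ : Module.Dual ℂ V), μ e = 0 ∧ ∀ x y, A x y = (μ x * h y e) • e by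
    obtain ⟨e, μ, hμ, hA⟩ := H
    refine ⟨e, μ, hμ, hA, fun x y => hext _ _ fun z => ?_⟩
    rw [← hA', hA, hsmul, hsmul', map_mul, Complex.conj_conj, hconj y e]
    ring
  obtain ⟨ν, φ, e, hνe, hA⟩ := exists_rank_one_of_leftSymmetric hd two_ne_zero A htr hls
  obtain ⟨n, hn⟩ := hriesz ν
  obtain ⟨f, hf⟩ := hriesz φ
  by_cases hn0 : n = 0
  · exact ⟨0, 0, by simp, fun x y => by
      rw [hA, hn, hn0, ← zero_smul ℂ (0 : V), hsmul']; simp⟩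
  by_cases he0 : e = 0
  · exact ⟨0, 0, by simp, fun x y => by rw [hA, he0]; simp⟩
  by_cases hef : ∃ c : ℂ, f = c • e
  · obtain ⟨c, rfl⟩ := hef
    refine ⟨e, conj c • ν, by simp [hνe], fun x y => ?_⟩
    rw [hA, hf, hsmul']
    congr 1
    simp; ring
  exfalso
  have orth : ∀ {u v w : V}, LinearIndependent ℂ ![u, v] → h u w = 0 → h v w = 0 → w = 0 := by
    intro u v w huv hu hv
    refine hnd w fun x => ?_
    obtain ⟨a, b, rfl⟩ := exists_smul_add_smul_of_finrank_two hd huv x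
    rw [hadd, hsmul, hsmul, hu, hv]; simp
  have li : ∀ {u v : V}, u ≠ 0 → (¬ ∃ c : ℂ, v = c • u) → LinearIndependent ℂ ![u, v] := by
    intro u v hu huv
    rw [LinearIndependent.pair_iff' hu]
    exact fun a ha => huv ⟨a, ha.symm⟩
  have hlef := li he0 hef
  have hen : h e n = 0 := by rw [← hn, hνe]
  have hne : h n e = 0 := by rw [hconj, hen, map_zero]
  have hAv : ∀ x y, A x y = (h x n * h y f) • e := fun x y => by rw [hA, hn, hf]
  have hA'v : ∀ x y, A' x y = (h n x * h y e) • f := fun x y => hext _ _ fun z => by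
    rw [← hA', hAv, hsmul, hsmul', map_mul, ← hconj, ← hconj]; ring
  -- If e and f were independent, the mixed identity at x = e would split into two scalar equations,
  -- its e- and f-coefficients.
  have key : ∀ y z,
      (h n y * h e e * h z n * h f f + h n y * h z e * h f n * h e f
        - h n y * h e e * h f n * h z f) • e +
      (h e e * h z n * (h e y * h n f - h e f * h n y)) • f = 0 := by
    intro y z
    have := hT e y z
    rw [← sub_eq_zero] at this
    simp only [hAv, hA'v, hsmul, hsmul', map_mul, ← hconj, hen, hne, map_zero] at this
    rw [← neg_eq_zero, ← this]
    module
  have k1 : ∀ y z, h n y * h e e * h z n * h f f + h n y * h z e * h f n * h e f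
        - h n y * h e e * h f n * h z f = 0 := fun y z =>
    ((LinearIndependent.pair_iff.1 hlef) _ _ (key y z)).1
  have k2 : ∀ y z, h e e * h z n * (h e y * h n f - h e f * h n y) = 0 := fun y z =>
    ((LinearIndependent.pair_iff.1 hlef) _ _ (key y z)).2
  obtain ⟨z₀, hz₀⟩ : ∃ z, h z n ≠ 0 := by
    by_contra! hz
    exact hn0 (hnd n hz)
  have hz₀' : h n z₀ ≠ 0 := by rw [hconj]; simpa using hz₀
  have hf0 : f ≠ 0 := fun h0 => hef ⟨0, by simp [h0]⟩
  by_cases hee : h e e = 0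
  -- For isotropic e the orthogonal complement of e is the line of e, and it contains n. The first
  -- scalar equation then makes f orthogonal to e, so e is in the radical.
  · have hnc : ∃ c : ℂ, n = c • e := by
      by_contra hnc
      exact he0 (orth (li he0 hnc) hee hne)
    obtain ⟨c, rfl⟩ := hnc
    have hc : c ≠ 0 := by rintro rfl; simp at hn0
    obtain ⟨z₁, hz₁⟩ : ∃ z, h z e ≠ 0 := by
      by_contra! hz
      exact he0 (hnd e hz)
    have := k1 z₀ z₁
    simp only [hee, mul_zero, zero_mul, zero_add, sub_zero, mul_eq_zero, hz₀', hz₁, false_or] at this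
    have hfe : h e f = 0 := by
      rcases this with h1 | h1
      · rw [hsmul', mul_eq_zero] at h1
        rw [hconj, h1.resolve_left (by simpa using hc), map_zero]
      · exact h1
    exact he0 (orth hlef hee (by rw [hconj, hfe, map_zero]))
  -- For non-isotropic e the vectors e and n are an orthogonal basis, and the second scalar equation
  -- makes f orthogonal to both.
  · have k3 : ∀ y, h e y * h n f - h e f * h n y = 0 := fun y => by
      have := k2 y z₀
      simpa [hee, hz₀] using this
    have hnf : h n f = 0 := by
      have := k3 e
      rw [hne] at this
      simpa [hee] using this
    have hef' : h e f = 0 := by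
      have := k3 z₀
      rw [hnf] at this
      simpa [hz₀'] using this
    refine hf0 (orth (li he0 ?_) hef' hnf)
    rintro ⟨c, rfl⟩
    rw [hsmul', mul_eq_zero] at hen
    simp [hee] at hen
    simp [hen] at hn0

end ComplexPlane

/-! ### Symmetries of the connection and curvature of a Kähler Lie algebra. -/

section KahlerGeometry

variable {𝔤 : Type*} [LieRing 𝔤] [LieAlgebra ℝ 𝔤]

/-- In an almost Hermitian structure `J` is skew for `ω`. -/
theorem IsKahlerStructure.apply_J_left {J : 𝔤 →ₗ[ℝ] 𝔤} {ω : LinearMap.BilinForm ℝ 𝔤}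
    (h : IsKahlerStructure J ω) (u v : 𝔤) : ω (J u) v = -ω u (J v) := by
  rw [← h.compatible u (J v), h.complex.sq, map_neg, neg_neg]

theorem IsKahlerStructure.metric_J_left {J : 𝔤 →ₗ[ℝ] 𝔤} {ω g : LinearMap.BilinForm ℝ 𝔤}
    (h : IsKahlerStructure J ω) (hgω : ∀ x y, g x y = ω (J x) y) (x y : 𝔤) :
    g (J x) y = -g x (J y) := by
  rw [hgω, hgω, h.apply_J_left]

variable [FiniteDimensional ℝ 𝔤]

/-- The Levi-Civita connection is metric. -/
theorem leviCivita_skew {g : LinearMap.BilinForm ℝ 𝔤} (hg : g.Nondegenerate)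
    (hs : ∀ x y, g x y = g y x) (x y z : 𝔤) :
    g (leviCivita g hg x y) z = -g y (leviCivita g hg x z) := by
  have h1 := leviCivita_koszul g hg x y z
  have h2 := leviCivita_koszul g hg x z y
  rw [hs y (leviCivita g hg x z)]
  have e1 : ⁅z, x⁆ = -⁅x, z⁆ := (lie_skew z x).symm
  have e2 : ⁅z, y⁆ = -⁅y, z⁆ := (lie_skew z y).symm
  have e3 : ⁅y, x⁆ = -⁅x, y⁆ := (lie_skew y x).symm
  rw [e1] at h1
  rw [e2, e3] at h2
  simp only [map_neg, LinearMap.neg_apply] at h1 h2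
  linarith

/-- The Levi-Civita connection is torsion free. -/
theorem leviCivita_sub_leviCivita {g : LinearMap.BilinForm ℝ 𝔤} (hg : g.Nondegenerate)
    (x y : 𝔤) :
    leviCivita g hg x y - leviCivita g hg y x = ⁅x, y⁆ := by
  rw [← sub_eq_zero]
  refine hg.1 _ fun z => ?_
  have h1 := leviCivita_koszul g hg x y z
  have h2 := leviCivita_koszul g hg y x z
  have e1 : ⁅z, x⁆ = -⁅x, z⁆ := (lie_skew z x).symm
  have e2 : ⁅z, y⁆ = -⁅y, z⁆ := (lie_skew z y).symm
  have e3 : ⁅y, x⁆ = -⁅x, y⁆ := (lie_skew y x).symm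
  rw [e1] at h1
  rw [e2, e3] at h2
  simp only [map_neg, LinearMap.neg_apply, map_sub, LinearMap.sub_apply] at h1 h2 ⊢
  linarith

/-- On a Kähler Lie algebra the complex structure is parallel. -/
theorem IsKahlerStructure.leviCivita_J {J : 𝔤 →ₗ[ℝ] 𝔤} {ω g : LinearMap.BilinForm ℝ 𝔤}
    (h : IsKahlerStructure J ω) (hgω : ∀ x y, g x y = ω (J x) y) (hg : g.Nondegenerate)
    (x y : 𝔤) : leviCivita g hg x (J y) = J (leviCivita g hg x y) := by
  rw [← sub_eq_zero]
  refine hg.1 _ fun z => ?_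
  -- In g((∇_x J)y, z) the Koszul terms combine into dω(x, y, z), dω(x, Jy, Jz) and the pairing of x
  -- with the Nijenhuis tensor of (y, z).
  have h1 := leviCivita_koszul g hg x (J y) z
  have h2 := leviCivita_koszul g hg x y (J z)
  have c1 := h.symplectic.closed x y z
  have c2 := h.symplectic.closed x (J y) (J z)
  have hN : J ⁅J y, z⁆ + J ⁅y, J z⁆ = ⁅J y, J z⁆ - ⁅y, z⁆ := by
    have := h.complex.integrable y z
    rw [← sub_eq_zero, ← neg_eq_zero, ← this]
    abel
  have hN' := congrArg (fun w => ω w x) hN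
  rw [map_sub, LinearMap.sub_apply, h.metric_J_left hgω]
  simp only [hgω, map_add, map_sub, LinearMap.add_apply, LinearMap.sub_apply,
    h.compatible] at *
  have a1 := h.apply_J_left ⁅x, J y⁆ z
  have a2 := h.apply_J_left ⁅J z, x⁆ y
  linarith

/-- The first Bianchi identity. -/
theorem leviCivita_bianchi {g : LinearMap.BilinForm ℝ 𝔤} (hg : g.Nondegenerate) (x y z : 𝔤) :
    curvature g hg x y z + curvature g hg y z x + curvature g hg z x y = 0 := by
  have hj := lie_jacobi x y z
  have t := fun a b => leviCivita_sub_leviCivita hg a b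
  rw [← t x ⁅y, z⁆, ← t y ⁅z, x⁆, ← t z ⁅x, y⁆] at hj
  simp only [curvature, LinearMap.sub_apply, Ring.lie_def, Module.End.mul_apply]
  have e : ∀ a b c, leviCivita g hg a ⁅b, c⁆ =
      leviCivita g hg a (leviCivita g hg b c) - leviCivita g hg a (leviCivita g hg c b) :=
    fun a b c => by rw [← t b c, map_sub]
  rw [e, e, e] at hj
  rw [← hj]
  abel

theorem curvature_apply {g : LinearMap.BilinForm ℝ 𝔤} (hg : g.Nondegenerate) (x y z : 𝔤) :
    curvature g hg x y z = leviCivita g hg x (leviCivita g hg y z)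
      - leviCivita g hg y (leviCivita g hg x z) - leviCivita g hg ⁅x, y⁆ z := rfl

theorem curvature_swap {g : LinearMap.BilinForm ℝ 𝔤} (hg : g.Nondegenerate) (x y z : 𝔤) :
    curvature g hg x y z = -curvature g hg y x z := by
  rw [curvature_apply, curvature_apply, ← lie_skew, map_neg, LinearMap.neg_apply]
  abel

theorem curvature_skew {g : LinearMap.BilinForm ℝ 𝔤} (hg : g.Nondegenerate)
    (hs : ∀ x y, g x y = g y x) (x y z w : 𝔤) :
    g (curvature g hg x y z) w = -g (curvature g hg x y w) z := by
  have k := leviCivita_skew hg hs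
  rw [hs (curvature g hg x y w) z]
  simp only [curvature_apply, map_sub, LinearMap.sub_apply, k _ (leviCivita g hg _ _), k ⁅x, y⁆,
    k _ z]
  ring

theorem curvature_pair_symm {g : LinearMap.BilinForm ℝ 𝔤} (hg : g.Nondegenerate)
    (hs : ∀ x y, g x y = g y x) (x y z w : 𝔤) :
    g (curvature g hg x y z) w = g (curvature g hg z w x) y := by
  have b : ∀ x y z w, g (curvature g hg x y z) w + g (curvature g hg y z x) w +
      g (curvature g hg z x y) w = 0 := fun x y z w => by
    rw [← LinearMap.add_apply, ← map_add, ← LinearMap.add_apply, ← map_add,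
      leviCivita_bianchi, map_zero, LinearMap.zero_apply]
  have s1 : ∀ x y z w, g (curvature g hg x y z) w = -g (curvature g hg y x z) w :=
    fun x y z w => by rw [curvature_swap, map_neg, LinearMap.neg_apply]
  have s2 := curvature_skew hg hs
  have b1 := b x y z w
  have b2 := b y z w x
  have b3 := b z w x y
  have b4 := b w x y z
  have := s2 y z x w
  have := s2 z x y w
  have := s2 x y z w
  have := s2 z w y x
  have := s2 w y z x
  have := s2 w x z y
  have := s1 z x w y
  have := s1 w y x z
  linarith

theorem IsKahlerStructure.curvature_J {J : 𝔤 →ₗ[ℝ] 𝔤} {ω g : LinearMap.BilinForm ℝ 𝔤}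
    (h : IsKahlerStructure J ω) (hgω : ∀ x y, g x y = ω (J x) y) (hg : g.Nondegenerate)
    (x y z : 𝔤) : curvature g hg x y (J z) = J (curvature g hg x y z) := by
  simp only [curvature_apply, map_sub, h.leviCivita_J hgω]

/-- The curvature of a Kähler Lie algebra is of type `(1, 1)`. -/
theorem IsKahlerStructure.curvature_J_J {J : 𝔤 →ₗ[ℝ] 𝔤} {ω g : LinearMap.BilinForm ℝ 𝔤}
    (h : IsKahlerStructure J ω) (hgω : ∀ x y, g x y = ω (J x) y) (hg : g.Nondegenerate)
    (hs : ∀ x y, g x y = g y x)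
    (x y z : 𝔤) : curvature g hg (J x) (J y) z = curvature g hg x y z := by
  rw [← sub_eq_zero]
  refine hg.1 _ fun w => ?_
  -- Pair symmetry moves J x, J y to the last slots, where R(z, w) commutes with the isometry J.
  rw [map_sub, LinearMap.sub_apply, curvature_pair_symm hg hs, curvature_pair_symm hg hs x,
    h.curvature_J hgω, h.metric_J_left hgω, h.complex.sq]
  simp

/-- Adjoint endomorphisms have the same trace. -/
theorem trace_eq_trace_of_adjoint {g : LinearMap.BilinForm ℝ 𝔤} (hg : g.Nondegenerate)
    {S T : Module.End ℝ 𝔤} (hT : ∀ y z, g (S y) z = g y (T z)) :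
    LinearMap.trace ℝ 𝔤 S = LinearMap.trace ℝ 𝔤 T := by
  -- The metric isomorphism with the dual conjugates S to the transpose of its adjoint.
  have h1 : (LinearMap.BilinForm.toDual g hg).conj S = Module.Dual.transpose (R := ℝ) T := by
    ext φ z
    obtain ⟨y, rfl⟩ := (LinearMap.BilinForm.toDual g hg).surjective φ
    rw [LinearEquiv.conj_apply_apply, LinearEquiv.symm_apply_apply]
    simp only [LinearMap.BilinForm.toDual_def, hT]
    rfl
  rw [← LinearMap.trace_conj' S (LinearMap.BilinForm.toDual g hg), h1, LinearMap.trace_transpose']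

/-- The trace of an endomorphism that is skew for a nondegenerate form vanishes. -/
theorem trace_eq_zero_of_skew {g : LinearMap.BilinForm ℝ 𝔤} (hg : g.Nondegenerate)
    {T : Module.End ℝ 𝔤} (hT : ∀ y z, g (T y) z = -g y (T z)) : LinearMap.trace ℝ 𝔤 T = 0 := by
  have := trace_eq_trace_of_adjoint hg (S := T) (T := -T) fun y z => by
    rw [hT, LinearMap.neg_apply, map_neg]
  rw [map_neg] at this
  linarith

/-- The divergence-type trace `tr (z ↦ ∇_z x)` vanishes on unimodular Lie algebras. -/
theorem trace_leviCivita_flip {g : LinearMap.BilinForm ℝ 𝔤} (hg : g.Nondegenerate)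
    (hs : ∀ x y, g x y = g y x) (hu : IsUnimodular 𝔤) (x : 𝔤) :
    LinearMap.trace ℝ 𝔤 ((leviCivita g hg).flip x) = 0 := by
  have e : (leviCivita g hg).flip x = leviCivita g hg x - LieAlgebra.ad ℝ 𝔤 x := by
    ext z
    simp [← leviCivita_sub_leviCivita hg x z]
  rw [e, map_sub, hu, trace_eq_zero_of_skew hg (leviCivita_skew hg hs x), sub_zero]

end KahlerGeometry

/-! ### Splitting a product, and its curvature, into complex types. -/

section TypeDecomposition

variable {E : Type*} [AddCommGroup E] [Module ℝ E]

/-- The part of the bilinear map `D` that is complex linear in the first argument. -/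
def holPart (J : E →ₗ[ℝ] E) (D : E →ₗ[ℝ] E →ₗ[ℝ] E) : E →ₗ[ℝ] E →ₗ[ℝ] E :=
  (1 / 2 : ℝ) • (D - (D ∘ₗ J).compr₂ J)

theorem holPart_apply (J : E →ₗ[ℝ] E) (D : E →ₗ[ℝ] E →ₗ[ℝ] E) (x y : E) :
    holPart J D x y = (1 / 2 : ℝ) • (D x y - J (D (J x) y)) := rfl

/-- Minus the part of the bilinear map `D` that is complex antilinear in the first argument. -/
def antiPart (J : E →ₗ[ℝ] E) (D : E →ₗ[ℝ] E →ₗ[ℝ] E) : E →ₗ[ℝ] E →ₗ[ℝ] E :=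
  -(1 / 2 : ℝ) • (D + (D ∘ₗ J).compr₂ J)

theorem antiPart_apply (J : E →ₗ[ℝ] E) (D : E →ₗ[ℝ] E →ₗ[ℝ] E) (x y : E) :
    antiPart J D x y = -(1 / 2 : ℝ) • (D x y + J (D (J x) y)) := rfl

/-- The curvature of a torsion-free product `D`. -/
def productCurvature (D : E →ₗ[ℝ] E →ₗ[ℝ] E) (x y z : E) : E :=
  D x (D y z) - D y (D x z) - D (D x y - D y x) z

variable {J : E →ₗ[ℝ] E} {D : E →ₗ[ℝ] E →ₗ[ℝ] E}

theorem holPart_sub_antiPart (x y : E) : holPart J D x y - antiPart J D x y = D x y := by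
  rw [holPart_apply, antiPart_apply]
  module

theorem holPart_J_left (hJ : ∀ x, J (J x) = -x) (x y : E) :
    holPart J D (J x) y = J (holPart J D x y) := by
  simp only [holPart_apply, hJ, map_neg, LinearMap.neg_apply, map_smul, map_sub]
  module

theorem holPart_J_right (hD : ∀ x y, D x (J y) = J (D x y)) (x y : E) :
    holPart J D x (J y) = J (holPart J D x y) := by
  simp only [holPart_apply, hD, map_smul, map_sub]

/-- The difference of the two sides is the (2,0) part of the curvature, which vanishes when the
curvature is J-invariant. -/
theorem holPart_leftSymmetric (hJ : ∀ x, J (J x) = -x) (hD : ∀ x y, D x (J y) = J (D x y))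
    (hK : ∀ x y z, productCurvature D (J x) (J y) z = productCurvature D x y z) (x y z : E) :
    holPart J D x (holPart J D y z) - holPart J D y (holPart J D x z) =
      holPart J D (holPart J D x y - holPart J D y x) z := by
  have h1 := hK x y z
  have h2 : productCurvature D (J x) y z + productCurvature D x (J y) z = 0 := by
    have := hK x (J y) z
    rw [← this, hJ]
    simp only [productCurvature, map_neg, LinearMap.neg_apply, map_sub, LinearMap.sub_apply]
    module
  have h3 : (1 / 4 : ℝ) • (productCurvature D x y z - productCurvature D (J x) (J y) z
      - J (productCurvature D (J x) y z + productCurvature D x (J y) z)) = 0 := by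
    rw [h1, h2]; simp
  rw [← sub_eq_zero, ← h3]
  simp only [holPart_apply, productCurvature, map_sub, map_smul, map_add, LinearMap.sub_apply,
    LinearMap.smul_apply, hD, hJ, map_neg, LinearMap.neg_apply]
  module

/-- Each side is, up to the factor -1/2, the expression K(x, y)z - J K(Jx, y)z. Its symmetry in x
and z follows from the Bianchi identity at (x, y, z) and at (Jx, y, Jz). -/
theorem holPart_mixed (hJ : ∀ x, J (J x) = -x) (hD : ∀ x y, D x (J y) = J (D x y))
    (hK : ∀ x y z, productCurvature D (J x) (J y) z = productCurvature D x y z)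
    (hB : ∀ x y z, productCurvature D x y z + productCurvature D y z x
      + productCurvature D z x y = 0) (x y z : E) :
    holPart J D x (antiPart J D y z) - antiPart J D y (holPart J D x z)
      + holPart J D (antiPart J D y x) z + antiPart J D (antiPart J D x y) z =
    holPart J D z (antiPart J D y x) - antiPart J D y (holPart J D z x)
      + holPart J D (antiPart J D y z) x + antiPart J D (antiPart J D z y) x := by
  have hS : ∀ x y z, holPart J D x (antiPart J D y z) - antiPart J D y (holPart J D x z)
      + holPart J D (antiPart J D y x) z + antiPart J D (antiPart J D x y) z =
      -(1 / 2 : ℝ) • (productCurvature D x y z - J (productCurvature D (J x) y z)) := by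
    intro x y z
    have h2 : productCurvature D x (J y) z = -productCurvature D (J x) y z := by
      rw [← hK x (J y) z, hJ]
      simp only [productCurvature, map_neg, LinearMap.neg_apply, map_sub, LinearMap.sub_apply]
      module
    have h3 : -(1 / 2 : ℝ) • (productCurvature D x y z - J (productCurvature D (J x) y z)) =
        -(1 / 4 : ℝ) • (productCurvature D x y z - J (productCurvature D (J x) y z)
          + J (productCurvature D x (J y) z) + productCurvature D (J x) (J y) z) := by
      rw [h2, hK, map_neg]; module
    rw [h3]
    simp only [holPart_apply, antiPart_apply, productCurvature, map_sub, map_smul, map_add,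
      LinearMap.sub_apply, LinearMap.smul_apply, LinearMap.add_apply, hD, hJ, map_neg,
      LinearMap.neg_apply]
    module
  rw [hS, hS]
  congr 1
  have hsw : ∀ x y z, productCurvature D x y z = -productCurvature D y x z := fun x y z => by
    simp only [productCurvature, map_sub, LinearMap.sub_apply]; abel
  have hKJ : ∀ x y z, productCurvature D x y (J z) = J (productCurvature D x y z) :=
    fun x y z => by simp only [productCurvature, hD, map_sub, LinearMap.sub_apply]
  have b1 := hB x y z
  have b2 := hB (J x) y (J z)
  rw [hKJ, hK, hsw y (J z) (J x), hKJ] at b2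
  rw [hsw y z x] at b1
  have e1 : productCurvature D x y z - productCurvature D z y x =
    -productCurvature D z x y := by
    rw [← sub_eq_zero, ← b1]; abel
  have e2 : J (productCurvature D (J x) y z) - J (productCurvature D (J z) y x) =
    -productCurvature D z x y := by
    rw [← sub_eq_zero, ← b2]; abel
  rw [← sub_eq_zero, ← sub_eq_zero.2 (e1.trans e2.symm)]
  abel

/-- The real trace of a complex-linear map. -/
theorem trace_restrictScalars_complex {V : Type*} [AddCommGroup V] [Module ℂ V] [mR : Module ℝ V]
    [IsScalarTower ℝ ℂ V] [FiniteDimensional ℂ V] (f : V →ₗ[ℂ] V) :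
    LinearMap.trace ℝ V (f.restrictScalars ℝ) = 2 * (LinearMap.trace ℂ V f).re := by
  let b := Module.finBasis ℂ V
  rw [LinearMap.trace_eq_matrix_trace ℝ (Complex.basisOneI.smulTower b),
    LinearMap.trace_eq_matrix_trace ℂ b, Matrix.trace, Matrix.trace, Fintype.sum_prod_type]
  simp only [Fin.sum_univ_two, Matrix.diag_apply, LinearMap.toMatrix_apply,
    Module.Basis.smulTower_repr, Module.Basis.smulTower_apply, LinearMap.restrictScalars_apply,
    map_smul, Finsupp.smul_apply]
  simp [Complex.coe_basisOneI, Complex.coe_basisOneI_repr, two_mul]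

end TypeDecomposition

/-! ### The normal form of the Levi-Civita connection. -/

section NormalForm

variable {𝔤 : Type*} [LieRing 𝔤] [LieAlgebra ℝ 𝔤]

theorem J_mul_J {J : Module.End ℝ 𝔤} (hJ : ∀ x, J (J x) = -x) : J * J = -1 :=
  LinearMap.ext fun x => by simpa using hJ x

/-- The complex vector space structure given by an endomorphism with square `-1`. -/
abbrev complexModule (J : 𝔤 →ₗ[ℝ] 𝔤) (hJ : ∀ x, J (J x) = -x) : Module ℂ 𝔤 :=
  Module.compHom 𝔤 (Complex.liftAux (J : Module.End ℝ 𝔤) (J_mul_J hJ)).toRingHom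

theorem complexModule_smul (J : 𝔤 →ₗ[ℝ] 𝔤) (hJ : ∀ x, J (J x) = -x) (c : ℂ) (x : 𝔤) :
    (letI := complexModule J hJ; c • x) = c.re • x + c.im • J x := by
  change Complex.liftAux (J : Module.End ℝ 𝔤) (J_mul_J hJ) c x = _
  simp [Complex.liftAux_apply]

variable [FiniteDimensional ℝ 𝔤]

theorem productCurvature_leviCivita {g : LinearMap.BilinForm ℝ 𝔤} (hg : g.Nondegenerate)
    (x y z : 𝔤) : productCurvature (leviCivita g hg) x y z = curvature g hg x y z := by
  rw [productCurvature, curvature_apply, leviCivita_sub_leviCivita]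

/-- The Levi-Civita connection of a pseudo-Kähler metric on a four-dimensional unimodular Lie
algebra. -/
theorem IsKahlerStructure.exists_leviCivita_eq (hd : Module.finrank ℝ 𝔤 = 4)
    (hu : IsUnimodular 𝔤) {J : 𝔤 →ₗ[ℝ] 𝔤} {ω g : LinearMap.BilinForm ℝ 𝔤}
    (h : IsKahlerStructure J ω) (hgω : ∀ x y, g x y = ω (J x) y) (hg : g.Nondegenerate)
    (hs : ∀ x y, g x y = g y x) :
    ∃ (e : 𝔤) (l : Module.Dual ℝ 𝔤), l e = 0 ∧ l (J e) = 0 ∧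
      ∀ x y, leviCivita g hg x y = l x • (g y e • J e - g y (J e) • e) := by
  have hJ := h.complex.sq
  have hgJ := h.metric_J_left hgω
  set D := leviCivita g hg with hDdef
  have hD : ∀ x y, D x (J y) = J (D x y) := h.leviCivita_J hgω hg
  have hDs : ∀ x y z, g (D x y) z = -g y (D x z) := leviCivita_skew hg hs
  let : Module ℂ 𝔤 := complexModule J hJ
  have hsm : ∀ (c : ℂ) (x : 𝔤), c • x = c.re • x + c.im • J x := complexModule_smul J hJ
  have : IsScalarTower ℝ ℂ 𝔤 := ⟨fun r c x => by
    rw [hsm, hsm]; simp [smul_smul]⟩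
  have : FiniteDimensional ℂ 𝔤 := FiniteDimensional.right ℝ ℂ 𝔤
  have hd2 : Module.finrank ℂ 𝔤 = 2 := by
    have := Module.finrank_mul_finrank ℝ ℂ 𝔤
    rw [Complex.finrank_real_complex, hd] at this
    omega
  let A : 𝔤 →ₗ[ℂ] 𝔤 →ₗ[ℂ] 𝔤 := LinearMap.mk₂ ℂ (fun x y => holPart J D x y)
    (fun a b y => by rw [map_add, LinearMap.add_apply])
    (fun c x y => by
      simp only [hsm, map_add, map_smul, LinearMap.add_apply, LinearMap.smul_apply,
        holPart_J_left hJ])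
    (fun x a b => by rw [map_add])
    (fun c x y => by simp only [hsm, map_add, map_smul, holPart_J_right hD])
  have hA : ∀ x y, A x y = holPart J D x y := fun _ _ => rfl
  let H : 𝔤 → 𝔤 → ℂ := fun x y => ⟨g x y, -g (J x) y⟩
  have hHre : ∀ x y, (H x y).re = g x y := fun _ _ => rfl
  have hHim : ∀ x y, (H x y).im = -g (J x) y := fun _ _ => rfl
  have hK : ∀ x y z, productCurvature D (J x) (J y) z = productCurvature D x y z :=
    fun x y z => by
      rw [productCurvature_leviCivita, productCurvature_leviCivita, h.curvature_J_J hgω hg hs]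
  have hB : ∀ x y z, productCurvature D x y z + productCurvature D y z x
      + productCurvature D z x y = 0 := fun x y z => by
    simp only [hDdef, productCurvature_leviCivita, leviCivita_bianchi]
  have htrR : ∀ x, LinearMap.trace ℝ 𝔤 ((A.flip x).restrictScalars ℝ) = 0 := by
    intro x
    have e1 : (A.flip x).restrictScalars ℝ =
        (1 / 2 : ℝ) • (D.flip x - (J : Module.End ℝ 𝔤) * (D.flip x * J)) := rfl
    have e2 : LinearMap.trace ℝ 𝔤 (D.flip x) = 0 := trace_leviCivita_flip hg hs hu x
    have e3 : D.flip x * J * (J : Module.End ℝ 𝔤) = -D.flip x := by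
      ext z; simp [hJ]
    rw [e1, map_smul, map_sub, LinearMap.trace_mul_comm, e3, map_neg, e2]
    simp
  have htr : ∀ x, LinearMap.trace ℂ 𝔤 (A.flip x) = 0 := by
    intro x
    -- The real trace is twice the real part of the complex one; replacing x by ix reaches the
    -- imaginary part.
    have t1 := htrR x
    have t2 := htrR (Complex.I • x)
    rw [trace_restrictScalars_complex] at t1 t2
    rw [map_smul, map_smul] at t2
    apply Complex.ext
    · simpa using t1
    · simpa using t2
  obtain ⟨e, μ, hμe, hAe, hA'e⟩ := exists_hermitian_rank_one hd2 H
    (fun x y z => by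
      apply Complex.ext
      · simp [hHre]
      · simp [hHim]; ring)
    (fun c x z => by
      apply Complex.ext <;> simp [hHre, hHim, hsm, hJ] <;> ring)
    (fun x y => by
      apply Complex.ext
      · simp [hHre, hs y x]
      · rw [Complex.conj_im, hHim, hHim, hgJ, hs y])
    (fun φ => by
      -- The vector representing Re φ for g represents φ for H: complex linearity of φ settles the
      -- imaginary part.
      refine ⟨(LinearMap.BilinForm.toDual g hg).symm
        (Complex.reLm ∘ₗ φ.restrictScalars ℝ), fun x => ?_⟩
      have hf : ∀ x, g x ((LinearMap.BilinForm.toDual g hg).symm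
          (Complex.reLm ∘ₗ φ.restrictScalars ℝ)) = (φ x).re := fun x => by
        rw [hs, LinearMap.BilinForm.apply_toDual_symm_apply]; rfl
      apply Complex.ext
      · rw [hHre, hf]
      · have : J x = Complex.I • x := by rw [hsm]; simp
        rw [hHim, hf, this, map_smul]
        simp)
    A (fun x y => antiPart J D x y)
    (fun x y z => by
      apply Complex.ext
      · simp only [hHre, hA, holPart_apply, antiPart_apply, map_smul, map_sub, map_add,
          LinearMap.smul_apply, LinearMap.sub_apply, hgJ, hDs, hD, smul_eq_mul]
        ring
      · simp only [hHim, hA, holPart_apply, antiPart_apply, map_smul, map_sub, map_add,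
          LinearMap.smul_apply, LinearMap.sub_apply, hgJ, hDs, hD, smul_eq_mul, hJ, map_neg,
          LinearMap.neg_apply]
        ring)
    htr
    (fun x y z => holPart_leftSymmetric hJ hD hK x y z)
    (fun x y z => holPart_mixed hJ hD hK hB x y z)
  -- A - A' has the factor μ - conj μ = 2i Im μ, whence l = 2 Im μ; the remaining i H(y, e) e is
  -- g(y, e) Je - g(y, Je) e.
  refine ⟨e, (2 : ℝ) • (Complex.imLm ∘ₗ μ.restrictScalars ℝ), by simp [hμe], ?_, fun x y => ?_⟩
  · have : J e = Complex.I • e := by rw [hsm]; simp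
    simp [this, hμe]
  · rw [← holPart_sub_antiPart (J := J) (D := D) x y, ← hA, hAe]
    erw [hA'e]
    rw [hsm, hsm]
    simp only [Complex.mul_re, Complex.mul_im, Complex.conj_re, Complex.conj_im, hHre, hHim, hgJ,
      LinearMap.smul_apply, LinearMap.comp_apply, Complex.imLm_coe,
      LinearMap.restrictScalars_apply, smul_eq_mul]
    module

end NormalForm

/-! ### Flatness and completeness. -/

section Consequences

variable {𝔤 : Type*} [LieRing 𝔤] [LieAlgebra ℝ 𝔤]

/-- The skew endomorphism `y ↦ g(y, e) J e - g(y, J e) e`. -/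
def skewRankTwo (g : LinearMap.BilinForm ℝ 𝔤) (J : 𝔤 →ₗ[ℝ] 𝔤) (e : 𝔤) : 𝔤 →ₗ[ℝ] 𝔤 :=
  (g.flip e).smulRight (J e) - (g.flip (J e)).smulRight e

theorem skewRankTwo_apply (g : LinearMap.BilinForm ℝ 𝔤) (J : 𝔤 →ₗ[ℝ] 𝔤) (e y : 𝔤) :
    skewRankTwo g J e y = g y e • J e - g y (J e) • e := rfl

theorem apply_skewRankTwo {g : LinearMap.BilinForm ℝ 𝔤} {J : 𝔤 →ₗ[ℝ] 𝔤} {e : 𝔤}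
    {l : Module.Dual ℝ 𝔤} (h1 : l e = 0) (h2 : l (J e) = 0) (y : 𝔤) :
    l (skewRankTwo g J e y) = 0 := by
  simp [skewRankTwo_apply, h1, h2]

variable [FiniteDimensional ℝ 𝔤]

theorem isFlat_of_leviCivita_eq {g : LinearMap.BilinForm ℝ 𝔤} {hg : g.Nondegenerate}
    {l : Module.Dual ℝ 𝔤} {M : 𝔤 →ₗ[ℝ] 𝔤} (hl : ∀ y, l (M y) = 0)
    (h : ∀ x y, leviCivita g hg x y = l x • M y) : IsFlat g hg := by
  intro x y
  ext z
  rw [curvature_apply, ← leviCivita_sub_leviCivita hg]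
  simp only [h, map_sub, map_smul, hl, LinearMap.sub_apply, LinearMap.smul_apply]
  simp only [smul_zero, sub_self, zero_smul, LinearMap.zero_apply, sub_zero]
  module

theorem isGeodesicallyComplete_of_leviCivita_eq {g : LinearMap.BilinForm ℝ 𝔤}
    {hg : g.Nondegenerate} {J : 𝔤 →ₗ[ℝ] 𝔤} (hJ : ∀ x, J (J x) = -x)
    (hgJ : ∀ x y, g (J x) y = -g x (J y)) (hs : ∀ x y, g x y = g y x) {e : 𝔤}
    {l : Module.Dual ℝ 𝔤} (h1 : l e = 0) (h2 : l (J e) = 0)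
    (h : ∀ x y, leviCivita g hg x y = l x • skewRankTwo g J e y) :
    IsGeodesicallyComplete g hg := by
  intro x₀
  have hM := skewRankTwo_apply g J e
  have hl := apply_skewRankTwo (g := g) h1 h2
  set M := skewRankTwo g J e
  set w := M x₀ with hw
  set q := g e e
  set c := l x₀
  have heJ : g e (J e) = 0 := by
    have := hgJ e e
    rw [hs] at this
    linarith
  have hJe : g (J e) (J e) = q := by rw [hgJ, hJ, map_neg, neg_neg]
  have hMw : M w = q • J w := by
    have hMe : M e = q • J e := by rw [hM, heJ, zero_smul, sub_zero]
    have hMJe : M (J e) = -(q • e) := by rw [hM, hs, heJ, hJe, zero_smul, zero_sub]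
    rw [hw, hM x₀]
    simp only [map_sub, map_smul, hMe, hMJe, hJ]
    module
  have hMJw : M (J w) = -(q • w) := by
    have hMe : M e = q • J e := by rw [hM, heJ, zero_smul, sub_zero]
    have hMJe : M (J e) = -(q • e) := by rw [hM, hs, heJ, hJe, zero_smul, zero_sub]
    rw [hw, hM x₀]
    simp only [map_sub, map_smul, hMe, hMJe, hJ, map_neg]
    module
  have hlJw : l (J w) = 0 := by
    rw [hw, hM x₀]
    simp [hJ, h1, h2]
  -- Since l keeps the value c, the equation is x' = -c M x. With M w = q Jw and M(Jw) = -q w, the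
  -- ansatz x₀ + a w + b Jw reduces it to this planar system.
  obtain ⟨a, b, ha0, hb0, ha, hb⟩ : ∃ a b : ℝ → ℝ, a 0 = 0 ∧ b 0 = 0 ∧
      (∀ t, HasDerivAt a (-c * (1 - q * b t)) t) ∧ ∀ t, HasDerivAt b (-c * (q * a t)) t := by
    by_cases hq : q = 0
    · refine ⟨fun t => -c * t, fun _ => 0, by simp, rfl, fun t => ?_, fun t => ?_⟩
      · simpa [hq] using (hasDerivAt_id t).const_mul (-c)
      · simpa [hq] using hasDerivAt_const t (0 : ℝ)
    · have hlin : ∀ t, HasDerivAt (fun s : ℝ => c * q * s) (c * q) t := fun t => by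
        simpa using (hasDerivAt_id t).const_mul (c * q)
      refine ⟨fun t => -Real.sin (c * q * t) / q, fun t => (1 - Real.cos (c * q * t)) / q,
        by simp, by simp, fun t => ?_, fun t => ?_⟩
      · refine ((hlin t).sin.neg.div_const q).congr_deriv ?_
        field_simp
        ring
      · refine (((hlin t).cos.const_sub 1).div_const q).congr_deriv ?_
        field_simp
  refine ⟨fun t => x₀ + a t • w + b t • J w, by simp [ha0, hb0], fun φ t => ?_⟩
  have hlt : l (x₀ + a t • w + b t • J w) = c := by
    simp only [map_add, map_smul, hlJw]
    rw [hw, hl]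
    simp [c]
  rw [h, hlt]
  simp only [map_add, map_smul, hMw, hMJw, ← hw, map_neg, smul_eq_mul]
  refine ((((ha t).mul_const (φ w)).const_add (φ x₀)).add
    ((hb t).mul_const (φ (J w)))).congr_deriv ?_
  ring

end Consequences

/-! ### Bracket tables and Kähler structures in coordinates. -/

section Tables

/-- The Lie algebra `𝔤` has, in the coordinates `E`, the bracket
`[x, y] = δ (x₀ y₁ - x₁ y₀) e₂ - ε (x₀ y₂ - x₂ y₀) e₁`. -/
def IsBracketTable {𝔤 : Type*} [LieRing 𝔤] [LieAlgebra ℝ 𝔤] (δ ε : ℝ)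
    (E : 𝔤 ≃ₗ[ℝ] (Fin 4 → ℝ)) : Prop :=
  ∀ x y, E ⁅x, y⁆ = ![0, -(ε * (E x 0 * E y 2 - E x 2 * E y 0)),
    δ * (E x 0 * E y 1 - E x 1 * E y 0), 0]

variable {𝔤 𝔥 : Type*} [LieRing 𝔤] [LieAlgebra ℝ 𝔤] [LieRing 𝔥] [LieAlgebra ℝ 𝔥] {δ ε : ℝ}

theorem IsBracketTable.nonempty_lieEquiv {E : 𝔤 ≃ₗ[ℝ] (Fin 4 → ℝ)} {F : 𝔥 ≃ₗ[ℝ] (Fin 4 → ℝ)}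
    (hE : IsBracketTable δ ε E) (hF : IsBracketTable δ ε F) : Nonempty (𝔤 ≃ₗ⁅ℝ⁆ 𝔥) := by
  let T := E.trans F.symm
  have hT : ∀ x, F (T x) = E x := fun x => by simp [T]
  refine ⟨{ toLinearMap := T.toLinearMap, map_lie' := ?_, invFun := T.symm,
            left_inv := T.left_inv, right_inv := T.right_inv }⟩
  intro x y
  apply F.injective
  change F (T ⁅x, y⁆) = F ⁅T x, T y⁆
  rw [hT, hE, hF, hT, hT]

theorem IsBracketTable.comp {F : 𝔥 ≃ₗ[ℝ] (Fin 4 → ℝ)}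
    (hF : IsBracketTable δ ε F) (T : 𝔤 ≃ₗ⁅ℝ⁆ 𝔥) :
    IsBracketTable δ ε (T.toLinearEquiv.trans F) := by
  intro x y
  have : T.toLinearEquiv.trans F ⁅x, y⁆ = F ⁅T x, T y⁆ := by
    rw [← LieEquiv.map_lie]; rfl
  rw [this, hF]
  rfl

theorem IsBracketTable.isUnimodular {E : 𝔤 ≃ₗ[ℝ] (Fin 4 → ℝ)} (hE : IsBracketTable δ ε E) :
    IsUnimodular 𝔤 := by
  intro x
  rw [LinearMap.trace_eq_matrix_trace ℝ (Module.Basis.ofEquivFun E), Matrix.trace]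
  simp [Fin.sum_univ_four, LinearMap.toMatrix_apply, hE x _]

/-- The complex structure `e₀ ↦ e₁`, `e₂ ↦ e₃` of `ℝ⁴`. -/
def J₁ : (Fin 4 → ℝ) →ₗ[ℝ] (Fin 4 → ℝ) where
  toFun v := ![-v 1, v 0, -v 3, v 2]
  map_add' v w := by ext i; fin_cases i <;> simp <;> ring
  map_smul' c v := by ext i; fin_cases i <;> simp

/-- The symplectic form `e⁰ ∧ e² + e¹ ∧ e³` of `ℝ⁴`. -/
def ω₁ : LinearMap.BilinForm ℝ (Fin 4 → ℝ) :=
  LinearMap.mk₂ ℝ (fun v w => v 0 * w 2 - v 2 * w 0 + v 1 * w 3 - v 3 * w 1)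
    (fun _ _ _ => by simp only [Pi.add_apply]; ring)
    (fun _ _ _ => by simp only [Pi.smul_apply, smul_eq_mul]; ring)
    (fun _ _ _ => by simp only [Pi.add_apply]; ring)
    (fun _ _ _ => by simp only [Pi.smul_apply, smul_eq_mul]; ring)

/-- The complex structure `e₁ ↦ e₂`, `e₀ ↦ e₃` of `ℝ⁴`. -/
def J₂ : (Fin 4 → ℝ) →ₗ[ℝ] (Fin 4 → ℝ) where
  toFun v := ![-v 3, -v 2, v 1, v 0]
  map_add' v w := by ext i; fin_cases i <;> simp <;> ring
  map_smul' c v := by ext i; fin_cases i <;> simp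

/-- The symplectic form `e¹ ∧ e² + e⁰ ∧ e³` of `ℝ⁴`. -/
def ω₂ : LinearMap.BilinForm ℝ (Fin 4 → ℝ) :=
  LinearMap.mk₂ ℝ (fun v w => v 1 * w 2 - v 2 * w 1 + v 0 * w 3 - v 3 * w 0)
    (fun _ _ _ => by simp only [Pi.add_apply]; ring)
    (fun _ _ _ => by simp only [Pi.smul_apply, smul_eq_mul]; ring)
    (fun _ _ _ => by simp only [Pi.add_apply]; ring)
    (fun _ _ _ => by simp only [Pi.smul_apply, smul_eq_mul]; ring)

theorem ω₁_apply (v w : Fin 4 → ℝ) :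
    ω₁ v w = v 0 * w 2 - v 2 * w 0 + v 1 * w 3 - v 3 * w 1 := rfl

theorem ω₂_apply (v w : Fin 4 → ℝ) :
    ω₂ v w = v 1 * w 2 - v 2 * w 1 + v 0 * w 3 - v 3 * w 0 := rfl

theorem J₁_apply (v : Fin 4 → ℝ) : J₁ v = ![-v 1, v 0, -v 3, v 2] := rfl

theorem J₂_apply (v : Fin 4 → ℝ) : J₂ v = ![-v 3, -v 2, v 1, v 0] := rfl

/-- Kähler structures may be given in coordinates. -/
theorem isKahlerLieAlgebra_of_coordinates (E : 𝔤 ≃ₗ[ℝ] (Fin 4 → ℝ))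
    (J : (Fin 4 → ℝ) →ₗ[ℝ] (Fin 4 → ℝ)) (ω : LinearMap.BilinForm ℝ (Fin 4 → ℝ))
    (hJ : ∀ v, J (J v) = -v) (halt : ∀ v, ω v v = 0) (hnd : ∀ v, (∀ w, ω v w = 0) → v = 0)
    (hJω : ∀ v w, ω (J v) (J w) = ω v w)
    (hN : ∀ x y : 𝔤, E ⁅E.symm (J (E x)), E.symm (J (E y))⁆ - E ⁅x, y⁆
      - J (E ⁅E.symm (J (E x)), y⁆) - J (E ⁅x, E.symm (J (E y))⁆) = 0)
    (hd : ∀ x y z : 𝔤, ω (E ⁅x, y⁆) (E z) + ω (E ⁅y, z⁆) (E x) + ω (E ⁅z, x⁆) (E y) = 0) :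
    IsKahlerLieAlgebra 𝔤 := by
  have hsw : ∀ u v, ω u v = -ω v u := fun u v => by
    have := halt (u + v)
    simp only [map_add, LinearMap.add_apply, halt] at this
    linarith
  refine ⟨E.symm.toLinearMap ∘ₗ J ∘ₗ E.toLinearMap, ω.compl₁₂ E.toLinearMap E.toLinearMap,
    ⟨fun x => ?_, fun x y => ?_⟩, ⟨fun x => ?_, fun x y z => ?_, ?_, ?_⟩, fun x y => ?_⟩
  · simp [hJ]
  · apply E.injective
    simpa using hN x y
  · simpa using halt (E x)
  · simpa using hd x y z
  · intro x hx
    apply E.injective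
    rw [map_zero]
    exact hnd _ fun w => by simpa using hx (E.symm w)
  · intro x hx
    apply E.injective
    rw [map_zero]
    exact hnd _ fun w => by rw [hsw]; simpa using hx (E.symm w)
  · simp [hJω]

theorem IsBracketTable.isKahlerLieAlgebra_of_nilpotent {E : 𝔤 ≃ₗ[ℝ] (Fin 4 → ℝ)}
    (hE : IsBracketTable δ 0 E) : IsKahlerLieAlgebra 𝔤 := by
  refine isKahlerLieAlgebra_of_coordinates E J₁ ω₁ ?_ ?_ ?_ ?_ ?_ ?_
  · intro v; ext i; fin_cases i <;> simp [J₁_apply]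
  · intro v; rw [ω₁_apply]; ring
  · intro v hv
    -- The form pairs e₀ with e₂ and e₁ with e₃, so these four tests read off the coordinates up to
    -- sign.
    have h0 := hv (Pi.single 2 1)
    have h1 := hv (Pi.single 3 1)
    have h2 := hv (Pi.single 0 1)
    have h3 := hv (Pi.single 1 1)
    simp [ω₁_apply] at h0 h1 h2 h3
    ext i; fin_cases i <;> simp [h0, h1, h2, h3]
  · intro v w; simp [ω₁_apply, J₁_apply]; ring
  · intro x y
    simp only [hE _ _, LinearEquiv.apply_symm_apply, J₁_apply]
    ext i; fin_cases i <;> simp <;> ring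
  · intro x y z
    simp only [hE _ _, ω₁_apply]
    simp; ring

theorem IsBracketTable.isKahlerLieAlgebra_of_euclidean {E : 𝔤 ≃ₗ[ℝ] (Fin 4 → ℝ)}
    (hE : IsBracketTable 1 1 E) : IsKahlerLieAlgebra 𝔤 := by
  refine isKahlerLieAlgebra_of_coordinates E J₂ ω₂ ?_ ?_ ?_ ?_ ?_ ?_
  · intro v; ext i; fin_cases i <;> simp [J₂_apply]
  · intro v; rw [ω₂_apply]; ring
  · intro v hv
    have h0 := hv (Pi.single 2 1)
    have h1 := hv (Pi.single 3 1)
    have h2 := hv (Pi.single 0 1)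
    have h3 := hv (Pi.single 1 1)
    simp [ω₂_apply] at h0 h1 h2 h3
    ext i; fin_cases i <;> simp [h0, h1, h2, h3]
  · intro v w; simp [ω₂_apply, J₂_apply]; ring
  · intro x y
    simp only [hE _ _, LinearEquiv.apply_symm_apply, J₂_apply]
    ext i; fin_cases i <;> simp <;> ring
  · intro x y z
    simp only [hE _ _, ω₂_apply]
    simp; ring

end Tables

/-! ### Coordinates on the two model algebras. -/

section Models

/-- Coordinates on `ℝ × 𝔥₃`. -/
def heisenbergCoordinates : (ℝ × heisenberg3) ≃ₗ[ℝ] (Fin 4 → ℝ) where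
  toFun p := ![p.2.1 0 1, p.2.1 1 2, p.2.1 0 2, p.1]
  map_add' p q := by ext i; fin_cases i <;> simp
  map_smul' c p := by ext i; fin_cases i <;> simp
  invFun v := (v 3, ⟨!![0, v 0, v 2; 0, 0, v 1; 0, 0, 0], fun i j h => by
    fin_cases i <;> fin_cases j <;> simp at h ⊢⟩)
  left_inv p := by
    obtain ⟨r, A, hA⟩ := p
    refine Prod.ext (by simp) (Subtype.ext ?_)
    ext i j
    fin_cases i <;> fin_cases j <;> simp <;> exact (hA _ _ (by decide)).symm
  right_inv v := by ext i; fin_cases i <;> simp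

theorem isBracketTable_heisenberg : IsBracketTable 1 0 heisenbergCoordinates := by
  rintro ⟨r, A, hA⟩ ⟨s, B, hB⟩
  have h : heisenbergCoordinates ⁅((r, ⟨A, hA⟩) : ℝ × heisenberg3), (s, ⟨B, hB⟩)⁆ =
    ![(A * B - B * A) 0 1, (A * B - B * A) 1 2, (A * B - B * A) 0 2, r * s - s * r] :=
    rfl
  rw [h]
  have a : ∀ i j, j ≤ i → A i j = 0 := hA
  have b : ∀ i j, j ≤ i → B i j = 0 := hB
  ext i
  fin_cases i <;> simp [heisenbergCoordinates, Matrix.mul_apply, Fin.sum_univ_three, a, b] <;> ring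

/-- Coordinates on `ℝ × 𝔢(2)`. -/
def euclideanCoordinates : (ℝ × euclidean2) ≃ₗ[ℝ] (Fin 4 → ℝ) where
  toFun p := ![p.2.1 1 0, p.2.1 0 2, p.2.1 1 2, p.1]
  map_add' p q := by ext i; fin_cases i <;> simp
  map_smul' c p := by ext i; fin_cases i <;> simp
  invFun v := (v 3, ⟨!![0, -v 0, v 1; v 0, 0, v 2; 0, 0, 0], by simp, by simp, by simp,
    fun j => by fin_cases j <;> simp⟩)
  left_inv p := by
    obtain ⟨r, A, h1, h2, h3, h4⟩ := p
    refine Prod.ext (by simp) (Subtype.ext ?_)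
    ext i j
    fin_cases i <;> fin_cases j <;> simp [h1, h2, h3, h4]
  right_inv v := by ext i; fin_cases i <;> simp

theorem isBracketTable_euclidean : IsBracketTable 1 1 euclideanCoordinates := by
  rintro ⟨r, A, hA⟩ ⟨s, B, hB⟩
  have h : euclideanCoordinates ⁅((r, ⟨A, hA⟩) : ℝ × euclidean2), (s, ⟨B, hB⟩)⁆ =
    ![(A * B - B * A) 1 0, (A * B - B * A) 0 2, (A * B - B * A) 1 2, r * s - s * r] := rfl
  rw [h]
  obtain ⟨a1, a2, a3, a4⟩ := hA
  obtain ⟨b1, b2, b3, b4⟩ := hB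
  ext i
  fin_cases i <;> simp [euclideanCoordinates, Matrix.mul_apply, Fin.sum_univ_three, a1, a2, a3, a4,
    b1, b2, b3, b4] <;> ring

end Models

/-! ### From the normal form to a bracket table. -/

section Classification

variable {𝔤 : Type*} [LieRing 𝔤] [LieAlgebra ℝ 𝔤]

/-- Coordinates with respect to four independent vectors of a four-dimensional space. -/
theorem exists_coordinates [FiniteDimensional ℝ 𝔤] (hd : Module.finrank ℝ 𝔤 = 4) {v : Fin 4 → 𝔤}
    (hv : LinearIndependent ℝ v) : ∃ E : 𝔤 ≃ₗ[ℝ] (Fin 4 → ℝ), ∀ x,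
      x = E x 0 • v 0 + E x 1 • v 1 + E x 2 • v 2 + E x 3 • v 3 := by
  let b := basisOfLinearIndependentOfCardEqFinrank' v hv (by simp [hd])
  have hb : ∀ i, b i = v i := fun i => by simp [b]
  refine ⟨b.equivFun, fun x => ?_⟩
  conv_lhs => rw [← b.sum_equivFun x]
  rw [Fin.sum_univ_four, hb, hb, hb, hb]

theorem coordinates_eq {v : Fin 4 → 𝔤} (hv : LinearIndependent ℝ v) {E : 𝔤 ≃ₗ[ℝ] (Fin 4 → ℝ)}
    (hE : ∀ x, x = E x 0 • v 0 + E x 1 • v 1 + E x 2 • v 2 + E x 3 • v 3) {x : 𝔤} {c : Fin 4 → ℝ}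
    (hx : x = c 0 • v 0 + c 1 • v 1 + c 2 • v 2 + c 3 • v 3) : E x = c := by
  have h := Fintype.linearIndependent_iff.1 hv (fun i => E x i - c i) (by
    rw [Fin.sum_univ_four]
    have := (hE x).symm.trans hx
    rw [← sub_eq_zero] at this
    rw [← this]
    module)
  ext i
  exact sub_eq_zero.1 (h i)

theorem linearIndependent_fin_four {v : Fin 4 → 𝔤}
    (h : ∀ c₀ c₁ c₂ c₃ : ℝ, c₀ • v 0 + c₁ • v 1 + c₂ • v 2 + c₃ • v 3 = 0 →
      c₀ = 0 ∧ c₁ = 0 ∧ c₂ = 0 ∧ c₃ = 0) : LinearIndependent ℝ v := by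
  rw [Fintype.linearIndependent_iff]
  intro c hc
  rw [Fin.sum_univ_four] at hc
  obtain ⟨h0, h1, h2, h3⟩ := h _ _ _ _ hc
  intro i
  fin_cases i <;> assumption

/-- A vector and its image under a complex structure are independent over `ℝ`. -/
theorem eq_zero_of_smul_add_smul_J {J : 𝔤 →ₗ[ℝ] 𝔤} (hJ : ∀ x, J (J x) = -x) {e : 𝔤} (he : e ≠ 0)
    {a b : ℝ} (h : a • e + b • J e = 0) : a = 0 ∧ b = 0 := by
  have h' : a • J e - b • e = 0 := by
    have := congrArg J h
    simp only [map_add, map_smul, hJ, map_zero] at this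
    rw [← this]; module
  have h2 : (a ^ 2 + b ^ 2) • e = 0 := by
    have : (a ^ 2 + b ^ 2) • e = a • (a • e + b • J e) - b • (a • J e - b • e) := by module
    rw [this, h, h']; simp
  have h3 := (smul_eq_zero.1 h2).resolve_right he
  constructor <;> nlinarith [sq_nonneg a, sq_nonneg b]

/-- The Lie algebras determined by the normal form of the Levi-Civita connection. -/
theorem exists_isBracketTable [FiniteDimensional ℝ 𝔤] (hd : Module.finrank ℝ 𝔤 = 4)
    {g : LinearMap.BilinForm ℝ 𝔤} (hg : g.Nondegenerate) {J : 𝔤 →ₗ[ℝ] 𝔤} (hJ : ∀ x, J (J x) = -x)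
    (hgJ : ∀ x y, g (J x) y = -g x (J y)) (hs : ∀ x y, g x y = g y x) {e : 𝔤}
    {l : Module.Dual ℝ 𝔤} (h1 : l e = 0) (h2 : l (J e) = 0)
    (h : ∀ x y : 𝔤, ⁅x, y⁆ = l x • skewRankTwo g J e y - l y • skewRankTwo g J e x) :
    IsLieAbelian 𝔤 ∨ (∃ E : 𝔤 ≃ₗ[ℝ] (Fin 4 → ℝ), IsBracketTable 1 0 E) ∨
      ∃ E : 𝔤 ≃ₗ[ℝ] (Fin 4 → ℝ), IsBracketTable 1 1 E := by
  have hM := skewRankTwo_apply g J e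
  set M := skewRankTwo g J e
  by_cases hl : l = 0
  · exact Or.inl ⟨fun x y => by rw [h, hl]; simp⟩
  by_cases he : e = 0
  · exact Or.inl ⟨fun x y => by rw [h, hM, hM, he]; simp⟩
  right
  obtain ⟨u, hu⟩ : ∃ u, l u = 1 := by
    obtain ⟨u, hu⟩ := not_forall.1 fun h0 => hl (LinearMap.ext h0)
    exact ⟨(l u)⁻¹ • u, by simpa using inv_mul_cancel₀ hu⟩
  have heJ : g e (J e) = 0 := by
    have := hgJ e e
    rw [hs] at this
    linarith
  have hJe : g (J e) (J e) = g e e := by rw [hgJ, hJ, map_neg, neg_neg]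
  have hMe : M e = g e e • J e := by rw [hM, heJ, zero_smul, sub_zero]
  have hMJe : M (J e) = -(g e e • e) := by rw [hM, hs, heJ, hJe, zero_smul, zero_sub]
  by_cases hq : g e e = 0
  · left
    rw [hq, zero_smul] at hMe
    rw [hq, zero_smul, neg_zero] at hMJe
    -- If M killed ker l, then g(·, e) and g(·, Je) would both be multiples of l, contradicting the
    -- independence of e and Je.
    obtain ⟨v, hlv, hv⟩ : ∃ v, l v = 0 ∧ M v ≠ 0 := by
      by_contra! hcon
      have hx : ∀ x, g x e = l x * g u e ∧ g x (J e) = l x * g u (J e) := by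
        intro x
        have := hcon (x - l x • u) (by simp [hu])
        rw [hM] at this
        have := eq_zero_of_smul_add_smul_J hJ he (a := -g (x - l x • u) (J e))
          (b := g (x - l x • u) e) (by rw [← this]; module)
        simp at this
        constructor <;> linarith
      have h0 : g u (J e) • e + (-g u e) • J e = 0 := hg.2 _ fun x => by
        simp only [map_add, map_smul, (hx x).1, (hx x).2, smul_eq_mul]
        ring
      obtain ⟨-, hα⟩ := eq_zero_of_smul_add_smul_J hJ he h0
      exact he (hg.2 _ fun x => by rw [(hx x).1, neg_eq_zero.1 hα, mul_zero])
    have hlw : l (M v) = 0 := apply_skewRankTwo h1 h2 v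
    have hlJw : l (J (M v)) = 0 := by simp [hM, hJ, h1, h2]
    have hMw : M (M v) = 0 := by
      rw [hM v]; simp only [map_sub, map_smul, hMe, hMJe]; simp
    have hMJw : M (J (M v)) = 0 := by
      rw [hM v]; simp only [map_sub, map_smul, hMe, hMJe, hJ, map_neg]; simp
    set w := M v with hw
    -- Here [u, v] = w, while w and Jw are central, being killed by both l and M.
    have hli : LinearIndependent ℝ ![u, v, w, J w] := by
      refine linearIndependent_fin_four fun c₀ c₁ c₂ c₃ hc => ?_
      simp only [Matrix.cons_val] at hc
      have k0 : c₀ = 0 := by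
        have := congrArg l hc
        simpa [hu, hlv, hlw, hlJw] using this
      subst k0
      have k1 : c₁ = 0 := by
        have := congrArg M hc
        simpa [← hw, hMw, hMJw, hv] using this
      subst k1
      have := eq_zero_of_smul_add_smul_J hJ hv (a := c₂) (b := c₃) (by simpa using hc)
      exact ⟨rfl, rfl, this.1, this.2⟩
    obtain ⟨E, hE⟩ := exists_coordinates hd hli
    refine ⟨E, fun x y => coordinates_eq hli hE ?_⟩
    simp only [Matrix.cons_val] at hE ⊢
    have hlx : ∀ x, l x = E x 0 := fun x => by
      conv_lhs => rw [hE x]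
      simp [hu, hlv, hlw, hlJw]
    have hMx : ∀ x, M x = E x 0 • M u + E x 1 • w := fun x => by
      conv_lhs => rw [hE x]
      simp [← hw, hMw, hMJw]
    rw [h, hMx x, hMx y, hlx, hlx]
    module
  · right
    obtain ⟨v, hv, hv0⟩ : ∃ v, (l v = 0 ∧ g v e = 0 ∧ g v (J e) = 0) ∧ v ≠ 0 := by
      -- Three linear forms on a four-dimensional space have a common zero v ≠ 0; it spans the
      -- central factor ℝ.
      let T : 𝔤 →ₗ[ℝ] (Fin 3 → ℝ) := LinearMap.pi ![l, g.flip e, g.flip (J e)]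
      have hT : LinearMap.ker T ≠ ⊥ := LinearMap.ker_ne_bot_of_finrank_lt (by simp [hd])
      obtain ⟨v, hv, hv0⟩ := (Submodule.ne_bot_iff _).1 hT
      refine ⟨v, ⟨?_, ?_, ?_⟩, hv0⟩
      · exact congrFun hv 0
      · exact congrFun hv 1
      · exact congrFun hv 2
    obtain ⟨hlv, hve, hvJe⟩ := hv
    have hMv : M v = 0 := by rw [hM, hve, hvJe]; simp
    set q := g e e
    -- M rotates span(e, Je) with speed q, so the factor q⁻¹ normalises the action of the first
    -- vector.
    have hli : LinearIndependent ℝ ![q⁻¹ • u, e, J e, v] := by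
      refine linearIndependent_fin_four fun c₀ c₁ c₂ c₃ hc => ?_
      simp only [Matrix.cons_val] at hc
      have k0 : c₀ = 0 := by
        have := congrArg l hc
        simpa [hu, hlv, h1, h2, hq] using this
      subst k0
      have k1 : c₁ = 0 := by
        have := congrArg (fun x => g x e) hc
        simpa [hve, hs (J e) e, heJ, q, hq] using this
      subst k1
      have k2 : c₂ = 0 := by
        have := congrArg (fun x => g x (J e)) hc
        simpa [hvJe, hJe, heJ, q, hq] using this
      subst k2
      simpa [hv0] using hc
    obtain ⟨E, hE⟩ := exists_coordinates hd hli
    refine ⟨E, fun x y => coordinates_eq hli hE ?_⟩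
    simp only [Matrix.cons_val] at hE ⊢
    have hlx : ∀ x, l x = E x 0 * q⁻¹ := fun x => by
      conv_lhs => rw [hE x]
      simp [hu, hlv, h1, h2]
    -- The value of M at the first vector is not needed: its terms cancel by antisymmetry of the
    -- bracket.
    have hMx : ∀ x, M x = E x 0 • M (q⁻¹ • u) + E x 1 • q • J e - E x 2 • q • e := fun x => by
      conv_lhs => rw [hE x]
      simp only [map_add, map_smul, hMe, hMJe, hMv]
      module
    rw [h, hMx x, hMx y, hlx, hlx]
    match_scalars <;> field_simp <;> ring

end Classification

end PseudoKahler

theorem mainTheorem2 {𝔤 : Type*} [LieRing 𝔤] [LieAlgebra ℝ 𝔤] [FiniteDimensional ℝ 𝔤]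
    (hdim : Module.finrank ℝ 𝔤 = 4) :
    (PseudoKahler.IsUnimodular 𝔤 →
      ∀ (g : LinearMap.BilinForm ℝ 𝔤) (hg : PseudoKahler.IsPseudoKahlerMetric g),
        PseudoKahler.IsFlat g hg.nondegenerate ∧
        PseudoKahler.IsGeodesicallyComplete g hg.nondegenerate ∧
        (PseudoKahler.IsRicciFlat g hg.nondegenerate → PseudoKahler.IsFlat g hg.nondegenerate)) ∧
    ((PseudoKahler.IsUnimodular 𝔤 ∧ PseudoKahler.IsKahlerLieAlgebra 𝔤) ↔
      (IsLieAbelian 𝔤 ∨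
        Nonempty (𝔤 ≃ₗ⁅ℝ⁆ ℝ × PseudoKahler.heisenberg3) ∨
        Nonempty (𝔤 ≃ₗ⁅ℝ⁆ ℝ × PseudoKahler.euclidean2))) := by
  open PseudoKahler in
  refine ⟨fun hu g hg => ?_, ?_, ?_⟩
  · have hs := hg.symm
    obtain ⟨J, ω, hk, hgω⟩ := id hg
    obtain ⟨e, l, h1, h2, hD⟩ :=
      hk.exists_leviCivita_eq hdim hu hgω hg.nondegenerate hs
    have hflat : IsFlat g hg.nondegenerate :=
      isFlat_of_leviCivita_eq (M := skewRankTwo g J e) (apply_skewRankTwo h1 h2) hD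
    exact ⟨hflat, isGeodesicallyComplete_of_leviCivita_eq hk.complex.sq (hk.metric_J_left hgω) hs
      h1 h2 hD, fun _ => hflat⟩
  · rintro ⟨hu, J, ω, hk⟩
    have hg : IsPseudoKahlerMetric (ω ∘ₗ J) := ⟨J, ω, hk, fun _ _ => rfl⟩
    obtain ⟨e, l, h1, h2, hD⟩ :=
      hk.exists_leviCivita_eq hdim hu (g := ω ∘ₗ J) (fun _ _ => rfl) hg.nondegenerate hg.symm
    rcases exists_isBracketTable hdim hg.nondegenerate hk.complex.sq
      (hk.metric_J_left fun _ _ => rfl) hg.symm h1 h2 (fun x y => by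
        rw [← leviCivita_sub_leviCivita hg.nondegenerate, hD, hD]; rfl) with h | ⟨E, hE⟩ | ⟨E, hE⟩
    · exact Or.inl h
    · exact Or.inr (Or.inl (hE.nonempty_lieEquiv isBracketTable_heisenberg))
    · exact Or.inr (Or.inr (hE.nonempty_lieEquiv isBracketTable_euclidean))
  · rintro (h | ⟨⟨T⟩⟩ | ⟨⟨T⟩⟩)
    -- The abelian algebra is the degenerate case δ = 0 of the nilpotent table.
    · have hE : IsBracketTable 0 0 (Module.finBasisOfFinrankEq ℝ 𝔤 hdim).equivFun := by
        intro x y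
        rw [trivial_lie_zero, map_zero]
        ext i; fin_cases i <;> simp
      exact ⟨hE.isUnimodular, hE.isKahlerLieAlgebra_of_nilpotent⟩
    · have hE := isBracketTable_heisenberg.comp T
      exact ⟨hE.isUnimodular, hE.isKahlerLieAlgebra_of_nilpotent⟩
    · have hE := isBracketTable_euclidean.comp T
      exact ⟨hE.isUnimodular, hE.isKahlerLieAlgebra_of_euclidean⟩

end
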